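/- A (Kripke) frame is a pair $F=(W,R)$ with $W$ a nonempty set and $R\subseteq W\times W$. Modal formulas are built from countably many propositional variables and $\bot,\top$ by the Boolean connectives and one unary modality $\Diamond$, where $\Diamond\varphi$ is true at $w$ iff $\varphi$ is true at some $v$ with $wRv$. For a class $\mathcal C$ of frames, $\mathrm{Log}\,\mathcal C$ is the set of all formulas valid in $\mathcal C$, i.e. true at every point under every valuation on every frame of $\mathcal C$. A set of formulas has the finite model property if it equals $\mathrm{Log}\,\mathcal C$ for some class $\mathcal C$ of finite frames. Put $R^0=\mathrm{Id}_W$, $R^{i+1}=R^i\circ R$, and let $R^*=\bigcup_{i\ge 0}R^i$. Let $x\sim_R y$ iff $xR^*y$ and $yR^*x$; the quotient $W/{\sim_R}$ is partially ordered by $[x]\le_R[y]\iff xR^*y$. The frame $F$ has finite height if for some natural number $h$ this partial order contains a chain of cardinality $h$ and no chain of larger cardinality. Let $\mathcal F(m,n)$ be the class of all $(m,n)$-frames, i.e. frames with $R^n\subseteq R^m$, and $\mathcal G(m)$ the class of all $m$-transitive frames, i.e. frames with $R^*=\bigcup_{0\le i\le m}R^i$. Let $\mathcal F_*(m,n)$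 and $\mathcal G_*(m)$ be the classes of those frames in $\mathcal F(m,n)$ and $\mathcal G(m)$, respectively, that have finite height. **Corollary.** (1) For all integers $n>m\ge 1$, $\mathrm{Log}\,\mathcal F(m,n)$ has the finite model property if and only if $\mathrm{Log}\,\mathcal F(m,n)=\mathrm{Log}\,\mathcal F_*(m,n)$. (2) For every integer $m\ge 1$, $\mathrm{Log}\,\mathcal G(m)$ has the finite model property if and only if $\mathrm{Log}\,\mathcal G(m)=\mathrm{Log}\,\mathcal G_*(m)$. -/

import Mathlib

universe u

namespace ModalLogic

/-- Propositional modal formulas over the countable set of variables `p 0, p 1, …`. -/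
inductive Formula : Type
  | var (i : ℕ) : Formula
  | bot : Formula
  | top : Formula
  | neg (φ : Formula) : Formula
  | and (φ ψ : Formula) : Formula
  | or (φ ψ : Formula) : Formula
  | imp (φ ψ : Formula) : Formula
  | iff (φ ψ : Formula) : Formula
  | dia (φ : Formula) : Formula

/-- A Kripke frame: a nonempty set with a binary relation. -/
structure Frame : Type (u + 1) where
  W : Type u
  nonempty : Nonempty W
  R : W → W → Prop

/-- Truth of a formula at a point of the model over `F` with valuation `θ`. -/
def Frame.Sat (F : Frame.{u}) (θ : ℕ → Set F.W) : F.W → Formula → Prop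
  | w, .var i => w ∈ θ i
  | _, .bot => False
  | _, .top => True
  | w, .neg φ => ¬ F.Sat θ w φ
  | w, .and φ ψ => F.Sat θ w φ ∧ F.Sat θ w ψ
  | w, .or φ ψ => F.Sat θ w φ ∨ F.Sat θ w ψ
  | w, .imp φ ψ => F.Sat θ w φ → F.Sat θ w ψ
  | w, .iff φ ψ => (F.Sat θ w φ ↔ F.Sat θ w ψ)
  | w, .dia φ => ∃ v, F.R w v ∧ F.Sat θ v φ

/-- Validity in a frame: truth at every point of every model over it. -/
def Frame.Valid (F : Frame.{u}) (φ : Formula) : Prop :=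
  ∀ (θ : ℕ → Set F.W) (w : F.W), F.Sat θ w φ

/-- The logic of a class of frames: the set of all formulas valid in every frame of the class. -/
def Log (C : Set Frame.{u}) : Set Formula :=
  {φ | ∀ F ∈ C, F.Valid φ}

/-- The finite model property: being the logic of some class of finite frames. -/
def HasFMP (L : Set Formula) : Prop :=
  ∃ C : Set Frame.{u}, (∀ F ∈ C, Finite F.W) ∧ L = Log C

/-- Powers of a relation: `R⁰` is equality and `Rⁱ⁺¹ = Rⁱ ∘ R`. -/
def relPow {W : Type u} (R : W → W → Prop) : ℕ → W → W → Prop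
  | 0 => Eq
  | i + 1 => Relation.Comp (relPow R i) R

/-- The reflexive transitive closure of the relation of `F`. -/
def Frame.Reach (F : Frame.{u}) : F.W → F.W → Prop :=
  Relation.ReflTransGen F.R

/-- The equivalence whose classes are the clusters of `F`: mutual reachability. -/
def Frame.clusterSetoid (F : Frame.{u}) : Setoid F.W where
  r x y := F.Reach x y ∧ F.Reach y x
  iseqv :=
    { refl := fun _ => ⟨.refl, .refl⟩
      symm := fun h => ⟨h.2, h.1⟩
      trans := fun h k => ⟨h.1.trans k.1, k.2.trans h.2⟩ }

/-- The skeleton of `F`: the set of its clusters. -/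
def Frame.Skeleton (F : Frame.{u}) : Type u :=
  Quotient F.clusterSetoid

/-- The skeleton is partially ordered by `[x] ≤ [y]` iff `y` is reachable from `x`. -/
instance Frame.skeletonPartialOrder (F : Frame.{u}) : PartialOrder F.Skeleton where
  le := Quotient.lift₂ F.Reach fun _ _ _ _ h k =>
    propext ⟨fun r => (h.2.trans r).trans k.1, fun r => (h.1.trans r).trans k.2⟩
  le_refl := by
    rintro ⟨x⟩
    exact Relation.ReflTransGen.refl
  le_trans := by
    rintro ⟨x⟩ ⟨y⟩ ⟨z⟩ h k
    exact Relation.ReflTransGen.trans h k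
  le_antisymm := by
    rintro ⟨x⟩ ⟨y⟩ h k
    exact Quotient.sound ⟨h, k⟩

/-- A partial order has height `h` if it contains a chain of cardinality `h` and no chain of
greater cardinality. -/
def OrderHasHeight (P : Type u) [PartialOrder P] (h : ℕ) : Prop :=
  (∃ s : Set P, IsChain (· ≤ ·) s ∧ s.encard = (h : ℕ∞)) ∧
    ∀ s : Set P, IsChain (· ≤ ·) s → s.encard ≤ (h : ℕ∞)

/-- The height of a frame is the height of its skeleton. -/
def Frame.HasHeight (F : Frame.{u}) (h : ℕ) : Prop :=
  OrderHasHeight F.Skeleton h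

/-- A frame of finite height. -/
def Frame.HasFiniteHeight (F : Frame.{u}) : Prop :=
  ∃ h : ℕ, F.HasHeight h

/-- The class of all `(m,n)`-frames: `Rⁿ ⊆ Rᵐ`. -/
def classF (m n : ℕ) : Set Frame.{u} :=
  {F | ∀ x y, relPow F.R n x y → relPow F.R m x y}

/-- The class of all `(m,n)`-frames of finite height. -/
def classFstar (m n : ℕ) : Set Frame.{u} :=
  {F | F ∈ classF m n ∧ F.HasFiniteHeight}

/-- The class of all `m`-transitive frames: `R* = R⁰ ∪ R¹ ∪ … ∪ Rᵐ`. -/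
def classG (m : ℕ) : Set Frame.{u} :=
  {F | ∀ x y, F.Reach x y ↔ ∃ i ≤ m, relPow F.R i x y}

/-- The class of all `m`-transitive frames of finite height. -/
def classGstar (m : ℕ) : Set Frame.{u} :=
  {F | F ∈ classG m ∧ F.HasFiniteHeight}

end ModalLogic

/-! Both classes are definable by a modal formula, so finite frames whose logic is that of the class
belong to it, and they have finite height. Conversely, a formula refuted at finite height must be
refuted in a finite frame of the class. The witness is a minimal filtration through a finite
partition that refines the subformula types and is a bisimulation for a larger relation `S`
(`exists_tuned_refinement`). Here `S` is the union of the `R ^ (1 + k * d)` with `d = n - m` for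
`classF`, and `R*` for `classG`; in both cases `S ^ (1 + d) ⊆ S`, with `d = 1` for `R*`. Paths of
the quotient lift to `S`-paths of the same length (`Frame.exists_relPow_of_quot`). These expand to
`R`-paths, which the frame condition shortens and the quotient map projects back. -/

namespace ModalLogic

/-! ### Powers of a relation and path lengths modulo `d`. -/

section RelPow

variable {W : Type u} {R S : W → W → Prop}

theorem relPow_add {i j : ℕ} {x z : W} :
    relPow R (i + j) x z ↔ ∃ y, relPow R i x y ∧ relPow R j y z := by
  induction j generalizing z with
  | zero => simp [relPow]
  | succ j ih =>
    constructor
    · rintro ⟨w, h, hw⟩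
      obtain ⟨y, h₁, h₂⟩ := ih.1 h
      exact ⟨y, h₁, w, h₂, hw⟩
    · rintro ⟨y, h₁, w, h₂, hw⟩
      exact ⟨w, ih.2 ⟨y, h₁, h₂⟩, hw⟩

theorem relPow_one {x y : W} : relPow R 1 x y ↔ R x y := by
  simp [relPow, Relation.Comp]

theorem relPow_mul_of_self {l : ℕ} {x : W} (h : relPow R l x x) (k : ℕ) :
    relPow R (k * l) x x := by
  induction k with
  | zero => simp [relPow]
  | succ k ih =>
    rw [Nat.succ_mul]
    exact relPow_add.2 ⟨x, ih, h⟩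

theorem reflTransGen_of_relPow {i : ℕ} {x y : W} (h : relPow R i x y) :
    Relation.ReflTransGen R x y := by
  induction i generalizing y with
  | zero => exact h ▸ .refl
  | succ i ih =>
    obtain ⟨w, h, hw⟩ := h
    exact (ih h).tail hw

theorem exists_relPow_of_reflTransGen {x y : W} (h : Relation.ReflTransGen R x y) :
    ∃ i, relPow R i x y := by
  induction h with
  | refl => exact ⟨0, rfl⟩
  | tail _ hR ih =>
    obtain ⟨i, hi⟩ := ih
    exact ⟨i + 1, _, hi, hR⟩

theorem relPow_of_relPow_add_mul {m d : ℕ} (h : ∀ x y, relPow R (m + d) x y → relPow R m x y)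
    (k : ℕ) {x y : W} (hk : relPow R (m + k * d) x y) : relPow R m x y := by
  induction k generalizing y with
  | zero => simpa using hk
  | succ k ih =>
    apply ih
    rw [show m + (k + 1) * d = (m + d) + k * d by ring] at hk
    obtain ⟨z, h₁, h₂⟩ := relPow_add.1 hk
    exact relPow_add.2 ⟨z, h x z h₁, h₂⟩

/-- The union of the powers of `R` with exponents `1 + k * d`. -/
def stepClosure (R : W → W → Prop) (d : ℕ) (x y : W) : Prop :=
  ∃ k, relPow R (1 + k * d) x y

theorem exists_relPow_of_relPow_stepClosure {d j : ℕ} {x y : W}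
    (h : relPow (stepClosure R d) j x y) : ∃ k, relPow R (j + k * d) x y := by
  induction j generalizing y with
  | zero => exact ⟨0, by rw [Nat.zero_mul]; exact h⟩
  | succ j ih =>
    obtain ⟨w, h, k', hw⟩ := h
    obtain ⟨k, hk⟩ := ih h
    refine ⟨k + k', ?_⟩
    rw [show j + 1 + (k + k') * d = (j + k * d) + (1 + k' * d) by ring]
    exact relPow_add.2 ⟨w, hk, hw⟩

theorem stepClosure_of_relPow {d : ℕ} {x y : W} (h : relPow (stepClosure R d) (1 + d) x y) :
    relPow (stepClosure R d) 1 x y := by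
  obtain ⟨k, hk⟩ := exists_relPow_of_relPow_stepClosure h
  refine relPow_one.2 ⟨k + 1, ?_⟩
  rwa [show 1 + (k + 1) * d = 1 + d + k * d by ring]

/-- Two points of one cluster reached from a common point of it by paths whose lengths agree
modulo `d` are joined by a path of length divisible by `d`. -/
theorem exists_relPow_mul {d : ℕ} (hd : 1 ≤ d) {x₀ x y : W} {k l : ℕ} (hx : relPow S k x₀ x)
    (hy : relPow S l x₀ y) (hxx₀ : Relation.ReflTransGen S x x₀) (hkl : k % d = l % d) :
    ∃ j, relPow S (j * d) x y := by
  obtain ⟨q, hq⟩ := exists_relPow_of_reflTransGen hxx₀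
  -- Going round the loop through `x₀` `d - 1` times before leaving for `y` gives total length
  -- congruent to `d * (q + k)`, since `l ≡ k`.
  have h₁ := relPow_mul_of_self (relPow_add.2 ⟨x₀, hq, hx⟩) (d - 1)
  have h₂ := relPow_add.2 ⟨x, h₁, relPow_add.2 ⟨x₀, hq, hy⟩⟩
  have hdvd : d ∣ (d - 1) * (q + k) + (q + l) := by
    obtain ⟨e, rfl⟩ : ∃ e, d = e + 1 := ⟨d - 1, by omega⟩
    have : (e + 1 - 1) * (q + k) + (q + l) ≡ e * (q + k) + (q + k) [MOD (e + 1)] := by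
      simp only [Nat.add_sub_cancel]
      exact Nat.ModEq.add_left _ (Nat.ModEq.add_left _ hkl.symm)
    exact (this.dvd_iff dvd_rfl).2 ⟨q + k, by ring⟩
  obtain ⟨j, hj⟩ := hdvd
  exact ⟨j, by rwa [hj, mul_comm] at h₂⟩

end RelPow

/-! ### Finite tuned partitions at finite height. -/

section Tuned

variable {W : Type u} {S : W → W → Prop}

/-- In a relation of finite height with `S ^ (1 + d) ⊆ S`, every finite colouring is refined by a
finite colouring whose classes form a bisimulation. -/
theorem exists_tuned_refinement {K : Type} [Finite K] (c : W → K) {d : ℕ} (hd : 1 ≤ d)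
    (hS : ∀ x y, relPow S (1 + d) x y → relPow S 1 x y) (r : W → ℕ) (h : ℕ) (hr : ∀ x, r x < h)
    (hle : ∀ x y, S x y → r y ≤ r x)
    (heq : ∀ x y, S x y → r x = r y → Relation.ReflTransGen S y x) :
    ∃ (B : Type) (_ : Finite B) (b : W → B), (∀ x y, b x = b y → c x = c y) ∧
      ∀ x y x', b x = b y → S x x' → ∃ y', S y y' ∧ b x' = b y' := by
  classical
  let cl : Setoid W :=
    { r := fun x y => Relation.ReflTransGen S x y ∧ Relation.ReflTransGen S y x
      iseqv :=
        { refl := fun _ => ⟨.refl, .refl⟩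
          symm := fun h => ⟨h.2, h.1⟩
          trans := fun h k => ⟨h.1.trans k.1, k.2.trans h.2⟩ } }
  let q : W → Quotient cl := Quotient.mk cl
  have hq : ∀ {x y}, q x = q y →
      Relation.ReflTransGen S x y ∧ Relation.ReflTransGen S y x := fun h => Quotient.exact h
  have hout : ∀ x, ∃ l, relPow S l (q x).out x := fun x =>
    exists_relPow_of_reflTransGen (hq (x := (q x).out) (y := x) (Quotient.out_eq _)).1
  choose l hl using hout
  let i : W → Fin d := fun x => ⟨l x % d, Nat.mod_lt _ hd⟩
  have hi : ∀ {x y}, q x = q y → i x = i y → ∃ j, relPow S (j * d) x y := by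
    intro x y hxy hij
    refine exists_relPow_mul hd (hl x) (hxy ▸ hl y) (hq (Quotient.out_eq (q x)).symm).1 ?_
    exact congrArg Fin.val hij
  -- Whether `S` relates two points depends only on their clusters and residues: detours within
  -- residue classes have length divisible by `d`, and `S` absorbs them.
  have hinv : ∀ {x x₁ y₁ y}, q x = q x₁ → i x = i x₁ → S x₁ y₁ → q y₁ = q y → i y₁ = i y →
      S x y := by
    intro x x₁ y₁ y h₁ h₂ h₃ h₄ h₅
    obtain ⟨j, hj⟩ := hi h₁ h₂
    obtain ⟨k, hk⟩ := hi h₄ h₅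
    refine relPow_one.1 (relPow_of_relPow_add_mul hS (j + k) ?_)
    rw [show 1 + (j + k) * d = j * d + (1 + k * d) by ring]
    exact relPow_add.2 ⟨_, hj, relPow_add.2 ⟨_, relPow_one.2 h₃, hk⟩⟩
  have hle' : ∀ {x y}, Relation.ReflTransGen S x y → r y ≤ r x := by
    intro x y hxy
    induction hxy with
    | refl => exact le_rfl
    | tail _ hS ih => exact (hle _ _ hS).trans ih
  -- Induction on rank. Points of rank below `k` are closed under `S`-successors, so each new layer
  -- sees only itself and classes already built.
  suffices H : ∀ k, ∃ (B : Type) (_ : Finite B) (b : W → B),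
      (∀ x y, r x < k → r y < k → b x = b y → c x = c y) ∧
      ∀ x y x', r x < k → r y < k → b x = b y → S x x' → ∃ y', S y y' ∧ b x' = b y' by
    obtain ⟨B, hB, b, h₁, h₂⟩ := H h
    exact ⟨B, hB, b, fun x y => h₁ x y (hr x) (hr y), fun x y x' => h₂ x y x' (hr x) (hr y)⟩
  intro k
  induction k with
  | zero => exact ⟨Unit, inferInstance, fun _ => (), by simp, by simp⟩
  | succ k ih =>
    obtain ⟨B, hB, b, hc, ht⟩ := ih
    -- A point of the new layer is classified by its residue, colour and lower classes seen,
    -- together with two invariants of its cluster: the types `g` realised there and the pairs of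
    -- residues `s` joined by `S`.
    let t : W → Fin d × K × Set B := fun x => (i x, c x, {β | ∃ z, S x z ∧ r z < k ∧ b z = β})
    let g : Quotient cl → Set (Fin d × K × Set B) := fun C => {τ | ∃ y, q y = C ∧ t y = τ}
    let s : Quotient cl → Set (Fin d × Fin d) := fun C =>
      {p | ∃ y y', q y = C ∧ q y' = C ∧ S y y' ∧ (i y, i y') = p}
    let b' : W → B ⊕ ((Fin d × K × Set B) × Set (Fin d × K × Set B) × Set (Fin d × Fin d)) :=
      fun x => if r x < k then .inl (b x) else .inr (t x, g (q x), s (q x))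
    have hb₁ : ∀ {x}, r x < k → b' x = .inl (b x) := fun hx => if_pos hx
    have hb₂ : ∀ {x}, ¬ r x < k → b' x = .inr (t x, g (q x), s (q x)) := fun hx => if_neg hx
    refine ⟨_, inferInstance, b', ?_, ?_⟩
    · intro x y _ _ hxy
      by_cases hx : r x < k <;> by_cases hy : r y < k
      · rw [hb₁ hx, hb₁ hy] at hxy
        exact hc x y hx hy (Sum.inl.inj hxy)
      · rw [hb₁ hx, hb₂ hy] at hxy
        cases hxy
      · rw [hb₂ hx, hb₁ hy] at hxy
        cases hxy
      · rw [hb₂ hx, hb₂ hy] at hxy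
        exact congrArg (fun p => p.1.2.1) (Sum.inr.inj hxy)
    · intro x y x' hxk hyk hxy hxx'
      by_cases hx : r x < k <;> by_cases hy : r y < k
      · rw [hb₁ hx, hb₁ hy] at hxy
        obtain ⟨y', hyy', hb⟩ := ht x y x' hx hy (Sum.inl.inj hxy) hxx'
        refine ⟨y', hyy', ?_⟩
        rw [hb₁ ((hle _ _ hxx').trans_lt hx), hb₁ ((hle _ _ hyy').trans_lt hy), hb]
      · rw [hb₁ hx, hb₂ hy] at hxy
        cases hxy
      · rw [hb₂ hx, hb₁ hy] at hxy
        cases hxy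
      · rw [hb₂ hx, hb₂ hy] at hxy
        have hxy := Sum.inr.inj hxy
        have htt : t x = t y := congrArg (fun p => p.1) hxy
        have hgg : g (q x) = g (q y) := congrArg (fun p => p.2.1) hxy
        have hss : s (q x) = s (q y) := congrArg (fun p => p.2.2) hxy
        by_cases hx' : r x' < k
        · have hmem : b x' ∈ (t x).2.2 := ⟨x', hxx', hx', rfl⟩
          rw [htt] at hmem
          obtain ⟨y', hyy', hy', hb⟩ := hmem
          exact ⟨y', hyy', by rw [hb₁ hx', hb₁ hy', hb]⟩
        -- A successor in the same layer stays in the cluster: `g` supplies a point of its type in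
        -- the cluster of `y`, and `s` with `hinv` supplies the edge.
        · have hqx : q x' = q x := by
            have := hle _ _ hxx'
            exact Quotient.sound ⟨heq _ _ hxx' (by omega), .single hxx'⟩
          have hmem : t x' ∈ g (q x) := ⟨x', hqx, rfl⟩
          rw [hgg] at hmem
          obtain ⟨y', hqy, hty⟩ := hmem
          have hmem : (i x, i x') ∈ s (q x) := ⟨x, x', rfl, hqx, hxx', rfl⟩
          rw [hss] at hmem
          obtain ⟨y₁, y₁', h₁, h₁', hS₁, hp⟩ := hmem
          have hiy : i x = i y := congrArg Prod.fst htt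
          have hiy' : i y' = i x' := congrArg Prod.fst hty
          have hyy' : S y y' := hinv h₁.symm (hiy.symm.trans (congrArg Prod.fst hp).symm) hS₁
            (h₁'.trans hqy.symm) ((congrArg Prod.snd hp).trans hiy'.symm)
          have hy' : ¬ r y' < k := fun hlt => hy ((hle' (hq hqy).1).trans_lt hlt)
          exact ⟨y', hyy', by rw [hb₂ hx', hb₂ hy', hqx, hqy, hty, hgg, hss]⟩

end Tuned

/-! ### Finite height and rank functions. -/

section Rank

/-- The rank is the coheight of the cluster, bounded because the range of a strict series is a
chain; maximal clusters get rank 0. -/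
theorem Frame.HasFiniteHeight.exists_rank {F : Frame.{u}} (hF : F.HasFiniteHeight) :
    ∃ (r : F.W → ℕ) (h : ℕ), (∀ x, r x < h) ∧ (∀ x y, F.Reach x y → r y ≤ r x) ∧
      ∀ x y, F.Reach x y → r x = r y → F.Reach y x := by
  obtain ⟨h, -, hh⟩ := hF
  let π : F.W → F.Skeleton := Quotient.mk F.clusterSetoid
  have hfin : ∀ p : F.Skeleton, Order.coheight p ≤ h := by
    intro p
    refine Order.coheight_le fun s _ => ?_
    have h₁ := hh (Set.range s) s.strictMono.monotone.isChain_range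
    rw [← Set.image_univ, s.strictMono.injective.encard_image, Set.encard_univ] at h₁
    simp only [ENat.card_eq_coe_fintype_card, Fintype.card_fin] at h₁
    exact le_trans (by exact_mod_cast Nat.le_succ _) h₁
  have hlt : ∀ p : F.Skeleton, Order.coheight p < ⊤ := fun p =>
    (hfin p).trans_lt (ENat.natCast_lt_top h)
  refine ⟨fun x => (Order.coheight (π x)).toNat, h + 1, fun x => ?_, fun x y hxy => ?_,
    fun x y hxy he => ?_⟩
  · exact Nat.lt_succ_of_le (ENat.toNat_le_of_le_natCast (hfin _))
  · exact ENat.toNat_le_toNat (Order.coheight_anti (show π x ≤ π y from hxy)) (hlt _).ne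
  · by_contra hyx
    have : π x < π y := lt_of_le_not_ge hxy hyx
    have he : (Order.coheight (π x)).toNat = (Order.coheight (π y)).toNat := he
    have := Order.coheight_strictAnti this (hlt _)
    rw [← ENat.natCast_toNat (hlt (π x)).ne, ← ENat.natCast_toNat (hlt (π y)).ne, he] at this
    exact lt_irrefl _ this

theorem Frame.hasFiniteHeight_of_finite (F : Frame.{u}) [Finite F.W] : F.HasFiniteHeight := by
  classical
  have : Finite F.Skeleton := Quotient.finite _
  let P : ℕ → Prop := fun n => ∃ s : Set F.Skeleton, IsChain (· ≤ ·) s ∧ s.encard = (n : ℕ∞)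
  have hP : P 0 := ⟨∅, Set.pairwise_empty _, by simp⟩
  refine ⟨Nat.findGreatest P (Nat.card F.Skeleton), Nat.findGreatest_spec (P := P) (Nat.zero_le _) hP,
    fun s hs => ?_⟩
  have hcard : s.encard = (s.ncard : ℕ∞) := (Set.toFinite s).cast_ncard_eq.symm
  rw [hcard]
  have hPs : P s.ncard := ⟨s, hs, hcard⟩
  exact_mod_cast Nat.le_findGreatest (Set.ncard_le_card s) hPs

end Rank

/-! ### Minimal filtrations. -/

section Filtration

/-- The set of subformulas of a formula. -/
def Formula.sub : Formula → Set Formula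
  | .var i => {.var i}
  | .bot => {.bot}
  | .top => {.top}
  | .neg φ => insert (.neg φ) φ.sub
  | .and φ ψ => insert (.and φ ψ) (φ.sub ∪ ψ.sub)
  | .or φ ψ => insert (.or φ ψ) (φ.sub ∪ ψ.sub)
  | .imp φ ψ => insert (.imp φ ψ) (φ.sub ∪ ψ.sub)
  | .iff φ ψ => insert (.iff φ ψ) (φ.sub ∪ ψ.sub)
  | .dia φ => insert (.dia φ) φ.sub

theorem Formula.finite_sub (φ : Formula) : φ.sub.Finite := by
  induction φ <;> simp [Formula.sub, *]

/-- The minimal filtration of a frame through the classes of a colouring. -/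
def Frame.quot (F : Frame.{u}) {B : Type} (b : F.W → B) : Frame.{u} where
  W := Quotient (Setoid.ker b)
  nonempty := F.nonempty.map (Quotient.mk _)
  R U V := ∃ u v, Quotient.mk _ u = U ∧ Quotient.mk _ v = V ∧ F.R u v

variable {F : Frame.{u}} {B : Type} {b : F.W → B}

theorem Frame.finite_quot [Finite B] : Finite (F.quot b).W :=
  Finite.of_injective (Quotient.lift b fun _ _ h => h) (by
    rintro ⟨x⟩ ⟨y⟩ h
    exact Quotient.sound h)

/-- The class of a point in the filtration. -/
def Frame.toQuot (F : Frame.{u}) {B : Type} (b : F.W → B) (x : F.W) : (F.quot b).W :=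
  Quotient.mk _ x

theorem Frame.toQuot_eq {x y : F.W} : F.toQuot b x = F.toQuot b y ↔ b x = b y :=
  ⟨fun h => Quotient.exact h, fun h => Quotient.sound h⟩

theorem Frame.toQuot_surjective : Function.Surjective (F.toQuot b) := Quotient.mk_surjective

theorem Frame.sat_quot (θ : ℕ → Set F.W) (φ : Formula)
    (hb : ∀ ψ ∈ φ.sub, ∀ x y, b x = b y → F.Sat θ x ψ → F.Sat θ y ψ) (x : F.W) :
    (F.quot b).Sat (fun i => F.toQuot b '' θ i) (F.toQuot b x) φ ↔ F.Sat θ x φ := by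
  induction φ generalizing x with
  | var i =>
    constructor
    · rintro ⟨y, hy, hyx⟩
      exact hb (.var i) rfl y x (Frame.toQuot_eq.1 hyx) hy
    · intro h
      exact ⟨x, h, rfl⟩
  | bot => exact Iff.rfl
  | top => exact Iff.rfl
  | neg φ ih => exact not_congr (ih (fun ψ hψ => hb ψ (.inr hψ)) x)
  | and φ ψ ih₁ ih₂ =>
    exact and_congr (ih₁ (fun χ hχ => hb χ (.inr (.inl hχ))) x)
      (ih₂ (fun χ hχ => hb χ (.inr (.inr hχ))) x)
  | or φ ψ ih₁ ih₂ =>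
    exact or_congr (ih₁ (fun χ hχ => hb χ (.inr (.inl hχ))) x)
      (ih₂ (fun χ hχ => hb χ (.inr (.inr hχ))) x)
  | imp φ ψ ih₁ ih₂ =>
    exact imp_congr (ih₁ (fun χ hχ => hb χ (.inr (.inl hχ))) x)
      (ih₂ (fun χ hχ => hb χ (.inr (.inr hχ))) x)
  | iff φ ψ ih₁ ih₂ =>
    exact iff_congr (ih₁ (fun χ hχ => hb χ (.inr (.inl hχ))) x)
      (ih₂ (fun χ hχ => hb χ (.inr (.inr hχ))) x)
  | dia φ ih =>
    have ih := ih fun ψ hψ => hb ψ (.inr hψ)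
    constructor
    · rintro ⟨V, ⟨u, v, hu, rfl, huv⟩, hV⟩
      exact hb (.dia φ) (.inl rfl) u x (Frame.toQuot_eq.1 hu) ⟨v, huv, (ih v).1 hV⟩
    · rintro ⟨v, hxv, hv⟩
      exact ⟨F.toQuot b v, ⟨x, v, rfl, rfl, hxv⟩, (ih v).2 hv⟩

theorem Frame.relPow_toQuot {i : ℕ} {x y : F.W} (h : relPow F.R i x y) :
    relPow (F.quot b).R i (F.toQuot b x) (F.toQuot b y) := by
  induction i generalizing y with
  | zero => exact congrArg _ h
  | succ i ih =>
    obtain ⟨w, h, hw⟩ := h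
    exact ⟨F.toQuot b w, ih h, w, y, rfl, rfl, hw⟩

/-- Consecutive edges of a quotient path meet only up to equivalence. The bisimulation property
moves each edge to the point already reached, at the cost of replacing `R` by `S`. -/
theorem Frame.exists_relPow_of_quot {S : F.W → F.W → Prop} (hRS : ∀ x y, F.R x y → S x y)
    (hb : ∀ x y x', b x = b y → S x x' → ∃ y', S y y' ∧ b x' = b y') {i : ℕ} {x : F.W}
    {V : (F.quot b).W} (h : relPow (F.quot b).R i (F.toQuot b x) V) :
    ∃ y, F.toQuot b y = V ∧ relPow S i x y := by
  induction i generalizing V with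
  | zero => exact ⟨x, h, rfl⟩
  | succ i ih =>
    obtain ⟨w, h, u, v, hu, rfl, huv⟩ := h
    obtain ⟨z, rfl, hz⟩ := ih h
    obtain ⟨y, hzy, hvy⟩ := hb u z v (Frame.toQuot_eq.1 hu) (hRS _ _ huv)
    exact ⟨y, Frame.toQuot_eq.2 hvy.symm, z, hz, hzy⟩

/-- A formula refuted in a frame of finite height is refuted in a finite minimal filtration
tuned with respect to a given relation `S` between `R` and its reflexive transitive closure. -/
theorem Frame.HasFiniteHeight.exists_filtration (hF : F.HasFiniteHeight) {φ : Formula}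
    (hφ : ¬ F.Valid φ) {S : F.W → F.W → Prop} (hRS : ∀ x y, F.R x y → S x y)
    (hSR : ∀ x y, S x y → F.Reach x y) {d : ℕ} (hd : 1 ≤ d)
    (hS : ∀ x y, relPow S (1 + d) x y → relPow S 1 x y) :
    ∃ (B : Type) (b : F.W → B), Finite (F.quot b).W ∧ ¬ (F.quot b).Valid φ ∧
      ∀ x y x', b x = b y → S x x' → ∃ y', S y y' ∧ b x' = b y' := by
  obtain ⟨r, h, hr, hle, heq⟩ := hF.exists_rank
  simp only [Frame.Valid, not_forall] at hφ
  obtain ⟨θ, w, hw⟩ := hφ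
  have := φ.finite_sub.to_subtype
  obtain ⟨B, hB, b, hc, ht⟩ := exists_tuned_refinement (S := S)
    (fun x => {ψ : φ.sub | F.Sat θ x ψ}) hd hS r h hr (fun x y h => hle x y (hSR x y h))
    (fun x y h he => Relation.ReflTransGen.mono hRS _ _ (heq x y (hSR x y h) he))
  refine ⟨B, b, Frame.finite_quot, fun hv => hw ?_, ht⟩
  refine (Frame.sat_quot θ φ (fun ψ hψ x y hxy hx => ?_) w).1 (hv _ _)
  have hx : (⟨ψ, hψ⟩ : φ.sub) ∈ {ψ : φ.sub | F.Sat θ x ψ} := hx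
  rwa [hc x y hxy] at hx

end Filtration

/-! ### Modal definability and the two classes. -/

section Axioms

theorem Frame.sat_iterate_dia {F : Frame.{u}} {θ : ℕ → Set F.W} {i : ℕ} {x : F.W} {φ : Formula} :
    F.Sat θ x (Formula.dia^[i] φ) ↔ ∃ y, relPow F.R i x y ∧ F.Sat θ y φ := by
  induction i generalizing φ with
  | zero => simp [relPow]
  | succ i ih =>
    rw [Function.iterate_succ_apply, ih]
    constructor
    · rintro ⟨y, hy, z, hz, h⟩
      exact ⟨z, ⟨y, hy, hz⟩, h⟩
    · rintro ⟨z, ⟨y, hy, hz⟩, h⟩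
      exact ⟨y, hy, z, hz, h⟩

theorem Frame.mem_classF_iff {F : Frame.{u}} {m n : ℕ} : F ∈ classF m n ↔
    F.Valid (.imp (Formula.dia^[n] (.var 0)) (Formula.dia^[m] (.var 0))) := by
  constructor
  · intro hF θ w h
    obtain ⟨y, hy, h⟩ := Frame.sat_iterate_dia.1 h
    exact Frame.sat_iterate_dia.2 ⟨y, hF _ _ hy, h⟩
  · intro hF x y hxy
    obtain ⟨z, hz, rfl⟩ := Frame.sat_iterate_dia.1
      (hF (fun _ => {y}) x (Frame.sat_iterate_dia.2 ⟨y, hxy, rfl⟩))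
    exact hz

/-- The disjunction of the formulas `◇ⁱ φ` over `i ≤ m`. -/
def Formula.diaLE (φ : Formula) : ℕ → Formula
  | 0 => φ
  | m + 1 => .or (φ.diaLE m) (Formula.dia^[m + 1] φ)

theorem Frame.sat_diaLE {F : Frame.{u}} {θ : ℕ → Set F.W} {m : ℕ} {x : F.W} {φ : Formula} :
    F.Sat θ x (φ.diaLE m) ↔ ∃ i ≤ m, ∃ y, relPow F.R i x y ∧ F.Sat θ y φ := by
  induction m with
  | zero => simp [Formula.diaLE, relPow]
  | succ m ih =>
    refine (or_congr ih Frame.sat_iterate_dia).trans ?_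
    constructor
    · rintro (⟨i, hi, h⟩ | h)
      · exact ⟨i, hi.trans m.le_succ, h⟩
      · exact ⟨m + 1, le_rfl, h⟩
    · rintro ⟨i, hi, h⟩
      rcases Nat.le_succ_iff.1 hi with hi | rfl
      · exact .inl ⟨i, hi, h⟩
      · exact .inr h

/-- It suffices to shorten paths of length `m + 1`; a singleton valuation turns the axiom into a
statement about one endpoint. -/
theorem Frame.mem_classG_iff {F : Frame.{u}} {m : ℕ} : F ∈ classG m ↔
    F.Valid (.imp (Formula.dia^[m + 1] (.var 0)) (Formula.diaLE (.var 0) m)) := by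
  constructor
  · intro hF θ w h
    obtain ⟨y, hy, h⟩ := Frame.sat_iterate_dia.1 h
    obtain ⟨i, hi, hy⟩ := (hF _ _).1 (reflTransGen_of_relPow hy)
    exact Frame.sat_diaLE.2 ⟨i, hi, y, hy, h⟩
  · intro hF x y
    refine ⟨fun hxy => ?_, fun ⟨i, _, h⟩ => reflTransGen_of_relPow h⟩
    induction hxy with
    | refl => exact ⟨0, Nat.zero_le _, rfl⟩
    | @tail y z _ hyz ih =>
      obtain ⟨i, hi, hy⟩ := ih
      have hz : relPow F.R (i + 1) x z := ⟨y, hy, hyz⟩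
      rcases hi.lt_or_eq with hi | rfl
      · exact ⟨i + 1, hi, hz⟩
      · obtain ⟨j, hj, v, hv, rfl⟩ := Frame.sat_diaLE.1
          (hF (fun _ => {z}) x (Frame.sat_iterate_dia.2 ⟨z, hz, rfl⟩))
        exact ⟨j, hj, hv⟩

end Axioms

theorem Log_anti {C D : Set Frame.{u}} (h : C ⊆ D) : Log D ⊆ Log C :=
  fun _ hφ F hF => hφ F (h hF)

/-- For a class `C` defined by a formula such that every formula refuted in a frame of `C` of
finite height is refuted in a finite frame of `C`, the logic of `C` has the finite model property
iff it is the logic of the frames of finite height in `C`. -/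
theorem hasFMP_iff_of_definable {C : Set Frame.{u}} {α : Formula}
    (hC : ∀ F : Frame.{u}, F ∈ C ↔ F.Valid α)
    (hfil : ∀ F ∈ C, F.HasFiniteHeight → ∀ φ, ¬ F.Valid φ →
      ∃ G ∈ C, Finite G.W ∧ ¬ G.Valid φ) :
    HasFMP.{u} (Log C) ↔ Log C = Log {F : Frame.{u} | F ∈ C ∧ F.HasFiniteHeight} := by
  constructor
  · rintro ⟨D, hD, hL⟩
    refine (Log_anti fun F hF => hF.1).antisymm ?_
    rw [hL]
    refine Log_anti fun F hF => ⟨(hC F).2 ?_, ?_⟩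
    · have : α ∈ Log C := fun G hG => (hC G).1 hG
      rw [hL] at this
      exact this F hF
    · have := hD F hF
      exact F.hasFiniteHeight_of_finite
  · intro hL
    refine ⟨{F | F ∈ C ∧ Finite F.W}, fun F hF => hF.2, ?_⟩
    refine (Log_anti fun F hF => hF.1).antisymm ?_
    rw [hL]
    rintro φ hφ F ⟨hF, hh⟩
    by_contra hv
    obtain ⟨G, hG, hfin, hGv⟩ := hfil F hF hh φ hv
    exact hGv (hφ G ⟨hG, hfin⟩)

theorem exists_finite_mem_classF {m n : ℕ} (hmn : m < n) {F : Frame.{u}} (hF : F ∈ classF m n)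
    (hh : F.HasFiniteHeight) {φ : Formula} (hφ : ¬ F.Valid φ) :
    ∃ G ∈ classF.{u} m n, Finite G.W ∧ ¬ G.Valid φ := by
  obtain ⟨d, hd, rfl⟩ : ∃ d, 1 ≤ d ∧ n = m + d := ⟨n - m, by omega, by omega⟩
  have hRS : ∀ x y, F.R x y → stepClosure F.R d x y := fun x y h =>
    ⟨0, by simpa using relPow_one.2 h⟩
  obtain ⟨B, b, hfin, hv, ht⟩ := hh.exists_filtration hφ hRS
    (fun x y ⟨k, hk⟩ => reflTransGen_of_relPow hk) hd (fun x y => stepClosure_of_relPow)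
  refine ⟨F.quot b, fun U V hUV => ?_, hfin, hv⟩
  obtain ⟨x, rfl⟩ := Frame.toQuot_surjective U
  obtain ⟨y, rfl, hxy⟩ := Frame.exists_relPow_of_quot hRS ht hUV
  obtain ⟨k, hk⟩ := exists_relPow_of_relPow_stepClosure hxy
  -- The lift has length `n + k * d = m + (k + 1) * d`, hence `k + 1` reductions.
  refine Frame.relPow_toQuot (relPow_of_relPow_add_mul hF (k + 1) ?_)
  rwa [show m + (k + 1) * d = m + d + k * d by ring]

theorem exists_finite_mem_classG {m : ℕ} {F : Frame.{u}} (hF : F ∈ classG m)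
    (hh : F.HasFiniteHeight) {φ : Formula} (hφ : ¬ F.Valid φ) :
    ∃ G ∈ classG.{u} m, Finite G.W ∧ ¬ G.Valid φ := by
  have hRS : ∀ x y, F.R x y → F.Reach x y := fun x y h => .single h
  have hcol : ∀ {i x y}, relPow F.Reach i x y → F.Reach x y := by
    intro i x y h
    replace h := reflTransGen_of_relPow h
    induction h with
    | refl => exact .refl
    | tail _ h ih => exact Relation.ReflTransGen.trans ih h
  obtain ⟨B, b, hfin, hv, ht⟩ := hh.exists_filtration hφ hRS (fun _ _ h => h) le_rfl
    (fun x y h => relPow_one.2 (hcol h))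
  refine ⟨F.quot b, fun U V => ⟨fun hUV => ?_, fun ⟨i, _, h⟩ => reflTransGen_of_relPow h⟩,
    hfin, hv⟩
  obtain ⟨x, rfl⟩ := Frame.toQuot_surjective U
  obtain ⟨i, hi⟩ := exists_relPow_of_reflTransGen hUV
  obtain ⟨y, rfl, hxy⟩ := Frame.exists_relPow_of_quot hRS ht hi
  obtain ⟨j, hj, h⟩ := (hF x y).1 (hcol hxy)
  exact ⟨j, hj, Frame.relPow_toQuot h⟩

end ModalLogic

theorem mainTheorem9 :
    (∀ m n : ℕ, 1 ≤ m → m < n →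
      (ModalLogic.HasFMP.{u} (ModalLogic.Log (ModalLogic.classF.{u} m n)) ↔
        ModalLogic.Log (ModalLogic.classF.{u} m n) =
          ModalLogic.Log (ModalLogic.classFstar.{u} m n))) ∧
    (∀ m : ℕ, 1 ≤ m →
      (ModalLogic.HasFMP.{u} (ModalLogic.Log (ModalLogic.classG.{u} m)) ↔
        ModalLogic.Log (ModalLogic.classG.{u} m) =
          ModalLogic.Log (ModalLogic.classGstar.{u} m))) :=
  ⟨fun _ _ _ hmn => ModalLogic.hasFMP_iff_of_definable
      (fun _ => ModalLogic.Frame.mem_classF_iff)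
      fun _ hF hh _ hφ => ModalLogic.exists_finite_mem_classF hmn hF hh hφ,
    fun _ _ => ModalLogic.hasFMP_iff_of_definable
      (fun _ => ModalLogic.Frame.mem_classG_iff)
      fun _ hF hh _ hφ => ModalLogic.exists_finite_mem_classG hF hh hφ⟩
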